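/- Conventions. A Banach analytic manifold is a Hausdorff topological space with an atlas of charts onto open subsets of a complex Banach space whose transition maps are holomorphic. For Banach analytic manifolds $A$ and $X$, $\operatorname{Hol}(A,X)$ is the set of holomorphic maps $A\to X$ with the compact-open topology; a sequence "converges in $\operatorname{Hol}(A,X)$" if it has a limit in this space. A space is locally separable if each of its points has a separable neighbourhood. $\Delta$ is the open unit disk in $\mathbb C$. For $S\subset A$ let $S^u$ be the set of all $z\in\overline S$ such that for every connected open neighbourhood $U$ of $z$ and every holomorphic $h:U\to\mathbb C$, $h|_{U\cap S}=0$ implies $h=0$ on $U$. For a sequence $\{f_k\}\subset\operatorname{Hol}(A,X)$ let $Z_{\{f_k\}}$ be the set of $\lambda\in A$ for which $\{f_k(\lambda)\}$ converges in $X$. We say that $X$ has the strong Vitali property (SVP) for the source $A$ if every sequence $\{f_k\}\subset\operatorname{Hol}(A,X)$ with $Z^u_{\{f_k\}}\neq\emptyset$ converges in $\operatorname{Hol}(A,X)$, and the weak Vitali property (WVP) for the source $A$ if every sequence $\{f_k\}\subset\operatorname{Hol}(A,X)$ with $Z_{\{f_k\}}\cap Z^u_{\{f_k\}}\neq\emptyset$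 converges in $\operatorname{Hol}(A,X)$. $X$ has the $1$-WVP if it has the WVP for the source $\Delta$, and $X$ has the WVP if it has the WVP for every connected Banach analytic manifold $A$ as source. A sequence $\{g_j\}\subset\operatorname{Hol}(A,X)$ is compactly divergent if for all compact $K\subset A$, $L\subset X$ there is $j_0$ with $g_j(K)\cap L=\emptyset$ for all $j\ge j_0$. $\operatorname{Hol}(A,X)$ is normal if every sequence in it has a subsequence which either converges in $\operatorname{Hol}(A,X)$ or is compactly divergent. Theorem 3.14. Let $X$ be a complex manifold modelled on a finite-dimensional complex vector space (Hausdorff; neither connectedness nor second countability is assumed). Then the following are equivalent: (i) $X$ has the $1$-WVP. (ii) $\operatorname{Hol}(A,X)$ is normal for every connected, locally separable Banach analytic manifold $A$. (iii) $X$ has the SVP for every connected, locally separable Banach analytic manifold $A$ as source. Moreover, if $X$ has the $1$-WVP, then $X$ has the WVP. -/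

import Mathlib

open Set Filter Topology
open scoped Manifold ContDiff

namespace Vitali

/- Throughout, a (complex) Banach analytic manifold modelled on the complex Banach space `E` is a
Hausdorff space `A` with `[ChartedSpace E A] [IsManifold 𝓘(ℂ, E) ω A]`; the model space of a
connected manifold is unique up to isomorphism, so one `E` is enough. Holomorphic means
complex (Fréchet) differentiable in charts, i.e. `MDifferentiable` over `ℂ`. -/

section Definitions

variable (E : Type*) [NormedAddCommGroup E] [NormedSpace ℂ E]
  (A : Type*) [TopologicalSpace A] [ChartedSpace E A]
  (F : Type*) [NormedAddCommGroup F] [NormedSpace ℂ F]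
  (X : Type*) [TopologicalSpace X] [ChartedSpace F X]

/-- `Hol(A, X)`: the holomorphic maps from `A` to `X`. As a subtype of `C(A, X)` it carries the
compact-open topology. -/
abbrev Hol : Type _ :=
  {f : C(A, X) // MDifferentiable 𝓘(ℂ, E) 𝓘(ℂ, F) (f : A → X)}

variable {A} in
/-- `S^u`: the points `z` in the closure of `S` such that, on every connected (open) neighbourhood
`U` of `z`, a holomorphic function `U → ℂ` that vanishes on `U ∩ S` vanishes identically. -/
def uniquenessSet (S : Set A) : Set A :=
  {z | z ∈ closure S ∧
    ∀ U : Set A, IsOpen U → IsConnected U → z ∈ U →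
      ∀ h : A → ℂ, MDifferentiableOn 𝓘(ℂ, E) 𝓘(ℂ, ℂ) h U →
        (∀ w ∈ U ∩ S, h w = 0) → ∀ w ∈ U, h w = 0}

variable {E A F X} in
/-- `Z_{(f_k)}`: the set of points at which the sequence converges in `X`. -/
def convergenceSet (f : ℕ → Hol E A F X) : Set A :=
  {a | ∃ x : X, Tendsto (fun k => (f k).1 a) atTop (𝓝 x)}

variable {E A F X} in
/-- The sequence converges in the space `Hol(A, X)`. -/
def ConvergesInHol (f : ℕ → Hol E A F X) : Prop :=
  ∃ g : Hol E A F X, Tendsto f atTop (𝓝 g)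

variable {E A F X} in
/-- The sequence is compactly divergent. -/
def CompactlyDivergent (f : ℕ → Hol E A F X) : Prop :=
  ∀ (K : Set A) (L : Set X), IsCompact K → IsCompact L →
    ∃ j₀ : ℕ, ∀ j ≥ j₀, ((f j).1 '' K) ∩ L = ∅

/-- `Hol(A, X)` is normal: each sequence has a subsequence which converges in `Hol(A, X)` or is
compactly divergent. -/
def IsNormalHol : Prop :=
  ∀ f : ℕ → Hol E A F X, ∃ φ : ℕ → ℕ, StrictMono φ ∧
    (ConvergesInHol (fun j => f (φ j)) ∨ CompactlyDivergent (fun j => f (φ j)))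

/-- The strong Vitali property of the target `X` for the single source manifold `A`. -/
def StrongVitaliFor : Prop :=
  ∀ f : ℕ → Hol E A F X,
    (uniquenessSet E (convergenceSet f)).Nonempty → ConvergesInHol f

/-- The weak Vitali property of the target `X` for the single source manifold `A`. -/
def WeakVitaliFor : Prop :=
  ∀ f : ℕ → Hol E A F X,
    (convergenceSet f ∩ uniquenessSet E (convergenceSet f)).Nonempty → ConvergesInHol f

end Definitions

/-- The open unit disk of `ℂ`, an open submanifold of `ℂ`. -/
def unitDisk : TopologicalSpace.Opens ℂ :=
  ⟨Metric.ball (0 : ℂ) 1, Metric.isOpen_ball⟩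

/-- Every point has a separable neighbourhood. -/
def LocallySeparable (A : Type*) [TopologicalSpace A] : Prop :=
  ∀ a : A, ∃ U ∈ 𝓝 a, TopologicalSpace.SeparableSpace U

section Properties

universe u

variable (F : Type*) [NormedAddCommGroup F] [NormedSpace ℂ F]
  (X : Type*) [TopologicalSpace X] [ChartedSpace F X]

/-- `X` has the 1-WVP: the weak Vitali property for the unit disk as source. -/
def HasOneWVP : Prop :=
  WeakVitaliFor ℂ unitDisk F X

/-- `X` has the WVP: the weak Vitali property for all connected Banach analytic manifolds `A`
(in the universe `u`). -/
def HasWVP : Prop :=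
  ∀ (E : Type u) [NormedAddCommGroup E] [NormedSpace ℂ E] [CompleteSpace E]
    (A : Type u) [TopologicalSpace A] [T2Space A] [ConnectedSpace A]
    [ChartedSpace E A] [IsManifold 𝓘(ℂ, E) ω A],
    WeakVitaliFor E A F X

/-- `Hol(A, X)` is normal for all connected, locally separable Banach analytic manifolds `A`
(in the universe `u`). -/
def NormalForLocallySeparable : Prop :=
  ∀ (E : Type u) [NormedAddCommGroup E] [NormedSpace ℂ E] [CompleteSpace E]
    (A : Type u) [TopologicalSpace A] [T2Space A] [ConnectedSpace A]
    [ChartedSpace E A] [IsManifold 𝓘(ℂ, E) ω A],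
    LocallySeparable A → IsNormalHol E A F X

/-- `X` has the SVP with respect to all connected, locally separable Banach analytic source
manifolds `A` (in the universe `u`). -/
def HasSVPForLocallySeparable : Prop :=
  ∀ (E : Type u) [NormedAddCommGroup E] [NormedSpace ℂ E] [CompleteSpace E]
    (A : Type u) [TopologicalSpace A] [T2Space A] [ConnectedSpace A]
    [ChartedSpace E A] [IsManifold 𝓘(ℂ, E) ω A],
    LocallySeparable A → StrongVitaliFor E A F X

end Properties

end Vitali

/-! The heart is that the 1-WVP forces equicontinuity (`HasOneWVP.tendsto_of_tendsto`). Suppose `a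
k` and `b k` tend to `z` and `f k (a k)` tends to `x`, but `f k (b k)` does not. For each `m`, some
late pair is joined by a holomorphic disk, which is then reparametrized by a polynomial vanishing at
`0` and at `1/2, 1/3, …, 1/(m+1)` but not at `-1/2`. The resulting maps on the disk converge to `x`
on a set accumulating at `0`. By the 1-WVP and the identity theorem they converge to `x` at `-1/2`
too, where they take the values `f k (b k)`: a contradiction.

Hence convergence at one point confines a tail of the sequence, near that point, to a compact part
of one chart. There the classical Vitali argument applies: cluster limits are holomorphic and agree
on the uniqueness set, hence everywhere nearby (`convergenceSet_mem_nhds`). Convergence spreads over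
the connected source along disks, again by the 1-WVP, which gives the WVP.

For normality, a sequence that is not compactly divergent has a subsequence converging at some
point; a diagonal choice on a countable dense set near it reduces to the WVP. Normality gives the
SVP because all subsequential limits agree on the convergence set. The SVP for the disk contains the
1-WVP. -/

namespace Vitali

/-! ### Bounded limits of holomorphic maps between normed spaces -/

section BoundedLimits

variable {E : Type*} [NormedAddCommGroup E] [NormedSpace ℂ E]
  {F : Type*} [NormedAddCommGroup F] [NormedSpace ℂ F]

/-- First and second order Cauchy estimates at the centre of a disk. -/
theorem norm_deriv_le_and_norm_sub_sub_deriv_le [CompleteSpace F] {ψ : ℂ → F} {R M : ℝ}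
    (hR : 0 < R) (hd : DifferentiableOn ℂ ψ (Metric.ball 0 R))
    (hM : ∀ t ∈ Metric.ball (0 : ℂ) R, ‖ψ t‖ ≤ M) :
    ‖deriv ψ 0‖ ≤ 2 * M / R ∧ (1 < R → ‖ψ 1 - ψ 0 - deriv ψ 0‖ ≤ 4 * M / R / R) := by
  have h0 : (0 : ℂ) ∈ Metric.ball (0 : ℂ) R := Metric.mem_ball_self hR
  have hη : ∀ t ∈ Metric.ball (0 : ℂ) R, ‖dslope ψ 0 t‖ ≤ 2 * M / R := by
    intro t ht
    refine Complex.norm_dslope_le_div_of_mapsTo_ball hd (fun s hs => ?_) ht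
    rw [mem_closedBall_iff_norm]
    linarith [norm_sub_le (ψ s) (ψ 0), hM s hs, hM 0 h0]
  have hηd : DifferentiableOn ℂ (dslope ψ 0) (Metric.ball 0 R) :=
    (Complex.differentiableOn_dslope (Metric.ball_mem_nhds _ hR)).2 hd
  refine ⟨by simpa using hη 0 h0, fun h1 => ?_⟩
  have h1' : (1 : ℂ) ∈ Metric.ball (0 : ℂ) R := by simpa using h1
  -- The second order remainder at `1` is the slope of the slope, so the Schwarz-type bound is
  -- applied again, now to `dslope ψ 0`.
  have := Complex.norm_dslope_le_div_of_mapsTo_ball (R₂ := 4 * M / R) hηd (fun s hs => ?_) h1'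
  · rw [dslope_of_ne _ one_ne_zero, slope_def_module, dslope_of_ne _ one_ne_zero,
      slope_def_module, dslope_same] at this
    simpa using this
  · rw [mem_closedBall_iff_norm]
    have e : 4 * M / R = 2 * M / R + 2 * M / R := by ring
    linarith [norm_sub_le (dslope ψ 0 s) (dslope ψ 0 0), hη s hs, hη 0 h0]

/-- Restriction to the complex line `t ↦ a + t • v`, on the disk of radius `r / ‖v‖`, reduces this
to one variable. The bounds depend on `φ` only through `M`, so they survive pointwise limits. -/
theorem norm_fderiv_apply_le_and_norm_sub_sub_fderiv_le [CompleteSpace F] {φ : E → F} {a : E}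
    {r M : ℝ} (hr : 0 < r) (hd : DifferentiableOn ℂ φ (Metric.ball a r))
    (hM : ∀ w ∈ Metric.ball a r, ‖φ w‖ ≤ M) (v : E) :
    ‖fderiv ℂ φ a v‖ ≤ 2 * M / r * ‖v‖ ∧
      (‖v‖ < r → ‖φ (a + v) - φ a - fderiv ℂ φ a v‖ ≤ 4 * M / r / r * ‖v‖ ^ 2) := by
  rcases eq_or_ne v 0 with rfl | hv
  · simp
  have hv' : 0 < ‖v‖ := norm_pos_iff.2 hv
  have hR : 0 < r / ‖v‖ := by positivity
  have hmaps : MapsTo (fun t : ℂ => a + t • v) (Metric.ball 0 (r / ‖v‖)) (Metric.ball a r) := by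
    intro t ht
    rw [mem_ball_zero_iff, lt_div_iff₀ hv'] at ht
    simpa [norm_smul] using ht
  have hline : ∀ t : ℂ, HasDerivAt (fun t : ℂ => a + t • v) v t := fun t => by
    simpa using ((hasDerivAt_id t).smul_const v).const_add a
  have hψ : DifferentiableOn ℂ (fun t : ℂ => φ (a + t • v)) (Metric.ball 0 (r / ‖v‖)) :=
    hd.comp (fun t _ => (hline t).differentiableAt.differentiableWithinAt) hmaps
  have hder : deriv (fun t : ℂ => φ (a + t • v)) 0 = fderiv ℂ φ a v := by
    have h : HasFDerivAt φ (fderiv ℂ φ a) (a + (0 : ℂ) • v) := by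
      simpa using (hd.differentiableAt (Metric.ball_mem_nhds _ hr)).hasFDerivAt
    exact (h.comp_hasDerivAt 0 (hline 0)).deriv
  have key := norm_deriv_le_and_norm_sub_sub_deriv_le hR hψ (fun t ht => hM _ (hmaps ht))
  rw [hder] at key
  refine ⟨key.1.trans_eq (by field_simp), fun h => ?_⟩
  have := key.2 ((one_lt_div hv').2 h)
  simp only [one_smul, zero_smul, add_zero] at this
  exact this.trans_eq (by field_simp)

/-- A pointwise limit, along any filter, of uniformly bounded holomorphic maps is holomorphic. -/
theorem differentiableAt_of_tendsto_of_norm_le [FiniteDimensional ℂ F] {ι : Type*}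
    {l : Filter ι} [l.NeBot] {φ : ι → E → F} {g : E → F} {a : E} {r M : ℝ} (hr : 0 < r)
    (hd : ∀ i, DifferentiableOn ℂ (φ i) (Metric.ball a r))
    (hM : ∀ i, ∀ w ∈ Metric.ball a r, ‖φ i w‖ ≤ M)
    (hg : ∀ w ∈ Metric.ball a r, Tendsto (fun i => φ i w) l (𝓝 (g w))) :
    DifferentiableAt ℂ g a := by
  have : CompleteSpace F := FiniteDimensional.complete ℂ F
  have : ProperSpace F := FiniteDimensional.proper ℂ F
  -- The derivatives at `a` are not known to converge along `l`, but they are bounded in a proper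
  -- space, so they converge along an ultrafilter. This yields the candidate derivative of `g`.
  set 𝒰 : Ultrafilter ι := Ultrafilter.of l
  have h𝒰 : (𝒰 : Filter ι) ≤ l := Ultrafilter.of_le l
  have key := fun i => norm_fderiv_apply_le_and_norm_sub_sub_fderiv_le hr (hd i) (hM i)
  have hlim : ∀ v : E, ∃ y : F, Tendsto (fun i => fderiv ℂ (φ i) a v) 𝒰 (𝓝 y) := by
    intro v
    obtain ⟨y, -, hy⟩ := (isCompact_closedBall (0 : F) (2 * M / r * ‖v‖)).ultrafilter_le_nhds
      (𝒰.map fun i => fderiv ℂ (φ i) a v)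
      (tendsto_principal.2 (Eventually.of_forall fun i => mem_closedBall_zero_iff.2 (key i v).1))
    exact ⟨y, hy⟩
  choose L₀ hL₀ using hlim
  let L₁ : E →ₗ[ℂ] F := linearMapOfTendsto L₀ (fun i => (fderiv ℂ (φ i) a : E →ₗ[ℂ] F))
    (l := (𝒰 : Filter ι)) (tendsto_pi_nhds.2 hL₀)
  let L : E →L[ℂ] F := L₁.mkContinuous (2 * M / r) fun v =>
    le_of_tendsto (hL₀ v).norm (Eventually.of_forall fun i => (key i v).1)
  have hL : ∀ v, Tendsto (fun i => fderiv ℂ (φ i) a v) 𝒰 (𝓝 (L v)) := hL₀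
  have hrem : ∀ w ∈ Metric.ball a r,
      ‖g w - g a - L (w - a)‖ ≤ 4 * M / r / r * ‖w - a‖ ^ 2 := by
    intro w hw
    refine le_of_tendsto ((((hg w hw).mono_left h𝒰).sub
      ((hg a (Metric.mem_ball_self hr)).mono_left h𝒰)).sub (hL (w - a))).norm
      (Eventually.of_forall fun i => ?_)
    simpa using (key i (w - a)).2 (mem_ball_iff_norm.1 hw)
  have hO : (fun w => g w - g a - L (w - a)) =O[𝓝 a] fun w => ‖w - a‖ ^ 2 := by
    refine Asymptotics.IsBigO.of_bound (4 * M / r / r) ?_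
    filter_upwards [Metric.ball_mem_nhds a hr] with w hw
    simpa using hrem w hw
  have h0 : DifferentiableAt ℂ (fun w => g w - g a - L (w - a)) a :=
    (hO.hasFDerivAt one_lt_two).differentiableAt
  have h1 := (h0.add
    (L.differentiableAt.comp a (differentiableAt_id.sub_const a))).add_const (g a)
  exact h1.congr_of_eventuallyEq (Eventually.of_forall fun w => by simp)

end BoundedLimits

/-! ### Charts, small holomorphic disks and propagation along them -/

theorem firstCountableTopology_of_chartedSpace (E : Type*) [NormedAddCommGroup E]
    (A : Type*) [TopologicalSpace A] [ChartedSpace E A] : FirstCountableTopology A := by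
  refine ⟨fun a => ?_⟩
  rw [← OpenPartialHomeomorph.symm_map_nhds_eq (chartAt E a) (mem_chart_source E a)]
  infer_instance

theorem exists_ball_subset_chartAt_target {E : Type*} [NormedAddCommGroup E]
    {A : Type*} [TopologicalSpace A] [ChartedSpace E A] {z : A} {U : Set A} (hU : U ∈ 𝓝 z) :
    ∃ r > 0, Metric.ball (chartAt E z z) r ⊆ (chartAt E z).target ∩ (chartAt E z).symm ⁻¹' U := by
  have hz := mem_chart_source E z
  refine Metric.mem_nhds_iff.1 (inter_mem ((chartAt E z).open_target.mem_nhds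
    (mem_chart_target E z)) ?_)
  rwa [← mem_map, (chartAt E z).symm_map_nhds_eq hz]

section Charts

variable {E : Type*} [NormedAddCommGroup E] [NormedSpace ℂ E]
  {A : Type*} [TopologicalSpace A] [ChartedSpace E A]
  {F : Type*} [NormedAddCommGroup F] [NormedSpace ℂ F]

/-- Any two points near `z` are the values, at `0` and at a prescribed other point of the unit
disk, of a holomorphic map from the disk into a prescribed neighbourhood of `z`. -/
theorem exists_disk_through [IsManifold 𝓘(ℂ, E) 1 A] {z : A} {U : Set A} (hU : U ∈ 𝓝 z) {ε : ℂ}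
    (hε : ε ≠ 0) :
    ∃ N ∈ 𝓝 z, N ⊆ U ∧ ∀ a ∈ N, ∀ b ∈ N, ∃ c : ℂ → A,
      MDifferentiableOn 𝓘(ℂ, ℂ) 𝓘(ℂ, E) c (Metric.ball 0 1) ∧
        MapsTo c (Metric.ball 0 1) U ∧ c 0 = a ∧ c ε = b := by
  obtain ⟨r, hr, hball⟩ := exists_ball_subset_chartAt_target (E := E) hU
  set e := chartAt E z
  have hε' : 0 < ‖ε‖ := norm_pos_iff.2 hε
  -- The first bound keeps the centre `e a` within `r / 2` of `e z`; the second keeps the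
  -- displacement `(t / ε) • (e b - e a)` below `r / 2`.
  set ρ : ℝ := min (r / 2) (r / 4 * ‖ε‖)
  have hρ : 0 < ρ := by positivity
  have hρ1 : ρ ≤ r / 2 := min_le_left _ _
  have hρ2 : ρ ≤ r / 4 * ‖ε‖ := min_le_right _ _
  have hz : z ∈ e.source := mem_chart_source E z
  refine ⟨e.source ∩ e ⁻¹' Metric.ball (e z) ρ, inter_mem (e.open_source.mem_nhds hz)
    ((e.continuousAt hz).preimage_mem_nhds (Metric.ball_mem_nhds _ hρ)), ?_, ?_⟩
  · rintro a ⟨ha, ha'⟩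
    have := (hball (Metric.ball_subset_ball (by linarith) ha')).2
    rwa [mem_preimage, e.left_inv ha] at this
  · rintro a ⟨ha, ha'⟩ b ⟨hb, hb'⟩
    rw [mem_preimage, mem_ball_iff_norm] at ha' hb'
    have hmaps : MapsTo (fun t : ℂ => e a + (t * ε⁻¹) • (e b - e a)) (Metric.ball 0 1)
        (Metric.ball (e z) r) := by
      intro t ht
      rw [mem_ball_zero_iff] at ht
      rw [mem_ball_iff_norm]
      have h1 : ‖e b - e a‖ < 2 * ρ := by
        have : e b - e a = (e b - e z) - (e a - e z) := by abel
        rw [this]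
        linarith [norm_sub_le (e b - e z) (e a - e z)]
      have h2 : ‖(t * ε⁻¹) • (e b - e a)‖ ≤ ‖ε‖⁻¹ * (2 * ρ) := by
        rw [norm_smul, norm_mul, norm_inv]
        gcongr
        exact mul_le_of_le_one_left (by positivity) ht.le
      have h3 : ‖ε‖⁻¹ * (2 * ρ) ≤ r / 2 := by
        rw [inv_mul_le_iff₀ hε']
        linarith
      have h4 : e a + (t * ε⁻¹) • (e b - e a) - e z
          = (e a - e z) + (t * ε⁻¹) • (e b - e a) := by abel
      rw [h4]
      linarith [norm_add_le (e a - e z) ((t * ε⁻¹) • (e b - e a))]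
    refine ⟨e.symm ∘ fun t : ℂ => e a + (t * ε⁻¹) • (e b - e a), ?_, ?_, ?_, ?_⟩
    · refine (mdifferentiableOn_atlas_symm (chart_mem_atlas E z)).comp ?_
        fun t ht => (hball (hmaps ht)).1
      have : Differentiable ℂ fun t : ℂ => e a + (t * ε⁻¹) • (e b - e a) := by fun_prop
      exact this.mdifferentiable.mdifferentiableOn
    · exact fun t ht => (hball (hmaps ht)).2
    · simp [e.left_inv ha]
    · simp [hε, e.left_inv hb]

/-- A set with nonempty interior which is stable under propagation along holomorphic disks
contains the ambient connected open set. -/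
theorem subset_of_disk_propagation [IsManifold 𝓘(ℂ, E) 1 A] {U Z : Set A} (hU : IsOpen U)
    (hUc : IsPreconnected U) (hne : (U ∩ interior Z).Nonempty)
    (H : ∀ c : ℂ → A, MDifferentiableOn 𝓘(ℂ, ℂ) 𝓘(ℂ, E) c (Metric.ball 0 1) →
      MapsTo c (Metric.ball 0 1) U → (∀ᶠ t in 𝓝 (0 : ℂ), c t ∈ Z) → c (1 / 2) ∈ Z) :
    U ⊆ Z := by
  refine (hUc.subset_of_closure_inter_subset isOpen_interior hne ?_).trans interior_subset
  rintro z ⟨hz, hzU⟩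
  obtain ⟨N, hN, -, hdisk⟩ := exists_disk_through (E := E) (hU.mem_nhds hzU)
    (ε := 1 / 2) (by norm_num)
  obtain ⟨a, haN, haZ⟩ := mem_closure_iff_nhds.1 hz N hN
  rw [mem_interior_iff_mem_nhds]
  refine mem_of_superset hN fun b hb => ?_
  obtain ⟨c, hc, hcU, rfl, rfl⟩ := hdisk a haN b hb
  refine H c hc hcU ?_
  have := (hc 0 (Metric.mem_ball_self one_pos)).continuousWithinAt.continuousAt
    (Metric.ball_mem_nhds _ one_pos)
  exact this (mem_interior_iff_mem_nhds.1 haZ)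

theorem mdifferentiableOn_of_tendsto_of_norm_le [IsManifold 𝓘(ℂ, E) 1 A] [FiniteDimensional ℂ F]
    {ι : Type*} {l : Filter ι} [l.NeBot] {φ : ι → A → F} {g : A → F} {U : Set A} {M : ℝ}
    (hU : IsOpen U) (hd : ∀ i, MDifferentiableOn 𝓘(ℂ, E) 𝓘(ℂ, F) (φ i) U)
    (hM : ∀ i, ∀ w ∈ U, ‖φ i w‖ ≤ M)
    (hg : ∀ w ∈ U, Tendsto (fun i => φ i w) l (𝓝 (g w))) :
    MDifferentiableOn 𝓘(ℂ, E) 𝓘(ℂ, F) g U := by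
  intro z hz
  obtain ⟨r, hr, hball⟩ := exists_ball_subset_chartAt_target (E := E) (hU.mem_nhds hz)
  set e := chartAt E z
  have hze : z ∈ e.source := mem_chart_source E z
  have hdiff : DifferentiableAt ℂ (fun v => g (e.symm v)) (e z) := by
    refine differentiableAt_of_tendsto_of_norm_le (φ := fun i v => φ i (e.symm v)) hr
      (fun i => ?_) (fun i w hw => hM i _ (hball hw).2) (fun w hw => hg _ (hball hw).2)
    rw [← mdifferentiableOn_iff_differentiableOn]
    exact (hd i).comp ((mdifferentiableOn_atlas_symm (chart_mem_atlas E z)).mono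
      fun v hv => (hball hv).1) fun v hv => (hball hv).2
  have h := hdiff.mdifferentiableAt.comp z
    (mdifferentiableAt_atlas (I := 𝓘(ℂ, E)) (chart_mem_atlas E z) hze)
  refine (h.congr_of_eventuallyEq ?_).mdifferentiableWithinAt
  filter_upwards [e.open_source.mem_nhds hze] with w hw
  exact (congrArg g (e.left_inv hw)).symm

end Charts

/-! ### Uniqueness sets and the identity theorem -/

section UniquenessSets

variable {E : Type*} [NormedAddCommGroup E] [NormedSpace ℂ E]
  {A : Type*} [TopologicalSpace A] [ChartedSpace E A]
  {F : Type*} [NormedAddCommGroup F] [NormedSpace ℂ F]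
  {X : Type*} [TopologicalSpace X] [ChartedSpace F X]

theorem uniquenessSet_mono {S T : Set A} (h : S ⊆ T) : uniquenessSet E S ⊆ uniquenessSet E T :=
  fun _ hz => ⟨closure_mono h hz.1, fun U hU hUc hzU f hf hfT =>
    hz.2 U hU hUc hzU f hf fun w hw => hfT w ⟨hw.1, h hw.2⟩⟩

theorem eqOn_zero_of_frequently_eq_zero_of_differentiableOn {h : ℂ → ℂ} {U : Set ℂ}
    (hU : IsOpen U) (hUc : IsPreconnected U) (hd : DifferentiableOn ℂ h U) {z : ℂ} (hz : z ∈ U)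
    (hfr : ∃ᶠ w in 𝓝[≠] z, h w = 0) : ∀ w ∈ U, h w = 0 :=
  (hd.analyticOnNhd hU).eqOn_zero_of_preconnected_of_frequently_eq_zero hUc hz hfr

/-- By continuity `h` vanishes near `z`; the one-variable identity theorem on disks then carries the
zero set over all of `U`. -/
theorem mem_uniquenessSet_of_mem_interior_closure [IsManifold 𝓘(ℂ, E) 1 A] {S : Set A} {z : A}
    (hz : z ∈ interior (closure S)) : z ∈ uniquenessSet E S := by
  refine ⟨interior_subset hz, fun U hU hUc hzU h hh hS => ?_⟩
  refine subset_of_disk_propagation (E := E) (Z := {w | h w = 0}) hU hUc.isPreconnected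
    ⟨z, hzU, ?_⟩ fun c hc hcU hc0 => ?_
  · rw [mem_interior_iff_mem_nhds]
    filter_upwards [hU.mem_nhds hzU, isOpen_interior.mem_nhds hz] with w hwU hw
    by_contra hne
    have hcont : ContinuousAt h w :=
      (hh w hwU).continuousWithinAt.continuousAt (hU.mem_nhds hwU)
    obtain ⟨s, ⟨hs, hsU⟩, hsS⟩ := mem_closure_iff_nhds.1 (interior_subset hw) _
      (inter_mem (hcont.eventually_ne hne) (hU.mem_nhds hwU))
    exact hs (hS s ⟨hsU, hsS⟩)
  · refine eqOn_zero_of_frequently_eq_zero_of_differentiableOn (h := h ∘ c) Metric.isOpen_ball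
      (convex_ball 0 1).isPreconnected ?_ (Metric.mem_ball_self one_pos) ?_ _
      (by simp; norm_num)
    · rw [← mdifferentiableOn_iff_differentiableOn]
      exact hh.comp hc hcU
    · exact (hc0.filter_mono nhdsWithin_le_nhds).frequently

theorem mem_uniquenessSet_of_mem_closure_interior [IsManifold 𝓘(ℂ, E) 1 A] {S : Set A} {z : A}
    (hz : z ∈ closure (interior S)) : z ∈ uniquenessSet E S := by
  refine ⟨closure_mono interior_subset hz, fun U hU hUc hzU => ?_⟩
  obtain ⟨w, hwU, hwS⟩ := mem_closure_iff.1 hz U hU hzU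
  exact (mem_uniquenessSet_of_mem_interior_closure (interior_mono subset_closure hwS)).2 U hU hUc
    hwU

theorem eqOn_of_mem_uniquenessSet [FiniteDimensional ℂ F] {S U : Set A} {z : A}
    (hz : z ∈ uniquenessSet E S) (hU : IsOpen U) (hUc : IsConnected U) (hzU : z ∈ U)
    {g₁ g₂ : A → F} (h₁ : MDifferentiableOn 𝓘(ℂ, E) 𝓘(ℂ, F) g₁ U)
    (h₂ : MDifferentiableOn 𝓘(ℂ, E) 𝓘(ℂ, F) g₂ U) (hS : ∀ w ∈ U ∩ S, g₁ w = g₂ w) :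
    EqOn g₁ g₂ U := by
  intro w hw
  refine (Module.Free.chooseBasis ℂ F).ext_elem fun i => ?_
  let ξ : F →L[ℂ] ℂ := ((Module.Free.chooseBasis ℂ F).coord i).toContinuousLinearMap
  have hξ : ∀ g : A → F, MDifferentiableOn 𝓘(ℂ, E) 𝓘(ℂ, F) g U →
      MDifferentiableOn 𝓘(ℂ, E) 𝓘(ℂ, ℂ) (fun w => ξ (g w)) U := fun g hg =>
    ξ.differentiable.mdifferentiable.comp_mdifferentiableOn hg
  have := hz.2 U hU hUc hzU (fun w => ξ (g₁ w) - ξ (g₂ w)) ((hξ g₁ h₁).sub (hξ g₂ h₂))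
    (fun w hw => by simp [hS w hw]) w hw
  exact sub_eq_zero.1 this

/-- The identity theorem for holomorphic maps between manifolds. -/
theorem eq_of_uniquenessSet_nonempty [IsManifold 𝓘(ℂ, E) 1 A] [PreconnectedSpace A] [T2Space X]
    [FiniteDimensional ℂ F] [IsManifold 𝓘(ℂ, F) 1 X] {g₁ g₂ : A → X}
    (h₁ : MDifferentiable 𝓘(ℂ, E) 𝓘(ℂ, F) g₁) (h₂ : MDifferentiable 𝓘(ℂ, E) 𝓘(ℂ, F) g₂)
    (hne : (uniquenessSet E {a | g₁ a = g₂ a}).Nonempty) : g₁ = g₂ := by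
  have : LocallyConnectedSpace A := ChartedSpace.locallyConnectedSpace E A
  have key : ∀ z ∈ uniquenessSet E {a | g₁ a = g₂ a}, z ∈ interior {a | g₁ a = g₂ a} := by
    intro z hz
    have hzeq : g₁ z = g₂ z := by
      have : IsClosed {a | g₁ a = g₂ a} := isClosed_eq h₁.continuous h₂.continuous
      exact this.closure_subset hz.1
    set e := chartAt F (g₁ z)
    have hsrc : g₁ ⁻¹' e.source ∩ g₂ ⁻¹' e.source ∈ 𝓝 z := by
      refine inter_mem (h₁.continuous.continuousAt.preimage_mem_nhds ?_)
        (h₂.continuous.continuousAt.preimage_mem_nhds ?_)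
      · exact e.open_source.mem_nhds (mem_chart_source F _)
      · rw [← hzeq]
        exact e.open_source.mem_nhds (mem_chart_source F _)
    obtain ⟨U, hUs, hU, hzU, hUc⟩ := locallyConnectedSpace_iff_subsets_isOpen_isConnected.1
      this z _ hsrc
    have he : MDifferentiableOn 𝓘(ℂ, F) 𝓘(ℂ, F) e e.source :=
      mdifferentiableOn_atlas (chart_mem_atlas F _)
    have := eqOn_of_mem_uniquenessSet hz hU hUc hzU
      (he.comp h₁.mdifferentiableOn fun w hw => (hUs hw).1)
      (he.comp h₂.mdifferentiableOn fun w hw => (hUs hw).2)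
      (fun w hw => congrArg e hw.2)
    rw [mem_interior]
    exact ⟨U, fun w hw => e.injOn (hUs hw).1 (hUs hw).2 (this hw), hU, hzU⟩
  obtain ⟨z, hz⟩ := hne
  have hsub := isPreconnected_univ.subset_of_closure_inter_subset
    (isOpen_interior (s := {a | g₁ a = g₂ a})) ⟨z, mem_univ z, key z hz⟩ ?_
  · exact funext fun a => (interior_subset (hsub (mem_univ a)) : a ∈ {a | g₁ a = g₂ a})
  · rintro w ⟨hw, -⟩
    exact key w (mem_uniquenessSet_of_mem_closure_interior hw)

end UniquenessSets

/-! ### The unit disk as a source -/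

section Disk

variable {E : Type*} [NormedAddCommGroup E] [NormedSpace ℂ E]
  {A : Type*} [TopologicalSpace A] [ChartedSpace E A]
  {F : Type*} [NormedAddCommGroup F] [NormedSpace ℂ F]
  {X : Type*} [TopologicalSpace X] [ChartedSpace F X]

theorem mdifferentiableAt_comp_subtype_val_iff {U : TopologicalSpace.Opens A} {f : A → X} {z : U} :
    MDifferentiableAt 𝓘(ℂ, E) 𝓘(ℂ, F) (f ∘ Subtype.val : U → X) z ↔
      MDifferentiableAt 𝓘(ℂ, E) 𝓘(ℂ, F) f z :=
  (differentiableWithinAt_localInvariantProp.liftPropAt_iff_comp_subtype_val f z).symm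

theorem mem_uniquenessSet_unitDisk {S : Set ℂ} {z : unitDisk}
    (hS : ∃ᶠ w in 𝓝[≠] (z : ℂ), w ∈ S) :
    z ∈ uniquenessSet ℂ (Subtype.val ⁻¹' S : Set unitDisk) := by
  have hemb : IsOpenEmbedding (Subtype.val : unitDisk → ℂ) := unitDisk.isOpen.isOpenEmbedding_subtypeVal
  refine ⟨?_, fun U hU hUc hzU h hh hS0 w hw => ?_⟩
  · rw [mem_closure_iff_frequently, hemb.isInducing.nhds_eq_comap, frequently_comap]
    refine ((hS.filter_mono nhdsWithin_le_nhds).and_eventually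
      (unitDisk.isOpen.mem_nhds z.2)).mono fun w hw => ⟨⟨w, hw.2⟩, rfl, hw.1⟩
  · set h' : ℂ → ℂ := Function.extend Subtype.val h 0
    have hh' : ∀ w : unitDisk, h' w = h w := fun w => Subtype.val_injective.extend_apply h 0 w
    have hcomp : h' ∘ (Subtype.val : unitDisk → ℂ) = h := funext hh'
    have hU' : IsOpen (Subtype.val '' U : Set ℂ) := hemb.isOpenMap U hU
    rw [← hh']
    refine eqOn_zero_of_frequently_eq_zero_of_differentiableOn hU'
      (hUc.isPreconnected.image _ continuous_subtype_val.continuousOn) ?_ (mem_image_of_mem _ hzU)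
      ?_ _ (mem_image_of_mem _ hw)
    · rintro _ ⟨v, hv, rfl⟩
      refine DifferentiableAt.differentiableWithinAt ?_
      rw [← mdifferentiableAt_iff_differentiableAt, ← mdifferentiableAt_comp_subtype_val_iff, hcomp]
      exact (hh v hv).mdifferentiableAt (hU.mem_nhds hv)
    · refine (hS.and_eventually (nhdsWithin_le_nhds
        (hU'.mem_nhds (mem_image_of_mem _ hzU)))).mono ?_
      rintro _ ⟨hwS, v, hv, rfl⟩
      rw [hh']
      exact hS0 v ⟨hv, hwS⟩

theorem tendsto_apply {f : ℕ → Hol E A F X} {g : Hol E A F X} (h : Tendsto f atTop (𝓝 g)) (a : A) :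
    Tendsto (fun k => (f k).1 a) atTop (𝓝 (g.1 a)) :=
  (((continuous_eval_const a).comp continuous_subtype_val).tendsto g).comp h

/-- The weak Vitali property for the disk, for maps defined on the plane. -/
theorem HasOneWVP.exists_limit (hX : HasOneWVP F X) {G : ℕ → ℂ → X}
    (hG : ∀ k, MDifferentiableOn 𝓘(ℂ, ℂ) 𝓘(ℂ, F) (G k) (Metric.ball 0 1))
    (h0 : ∃ x, Tendsto (fun k => G k 0) atTop (𝓝 x))
    (hS : ∃ᶠ t in 𝓝[≠] (0 : ℂ), ∃ x, Tendsto (fun k => G k t) atTop (𝓝 x)) :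
    ∃ g : Hol ℂ unitDisk F X, ∀ t : unitDisk, Tendsto (fun k => G k t) atTop (𝓝 (g.1 t)) := by
  have hmd : ∀ k, MDifferentiable 𝓘(ℂ, ℂ) 𝓘(ℂ, F) (G k ∘ (Subtype.val : unitDisk → ℂ)) :=
    fun k t => mdifferentiableAt_comp_subtype_val_iff.2
      ((hG k t t.2).mdifferentiableAt (unitDisk.isOpen.mem_nhds t.2))
  let f : ℕ → Hol ℂ unitDisk F X := fun k => ⟨⟨_, (hmd k).continuous⟩, hmd k⟩
  obtain ⟨g, hg⟩ := hX f ⟨⟨0, Metric.mem_ball_self one_pos⟩, h0, mem_uniquenessSet_unitDisk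
    (S := {t | ∃ x, Tendsto (fun k => G k t) atTop (𝓝 x)}) hS⟩
  exact ⟨g, tendsto_apply hg⟩

end Disk

/-! ### Equicontinuity from the 1-WVP -/

section Equicontinuity

variable {E : Type*} [NormedAddCommGroup E] [NormedSpace ℂ E]
  {A : Type*} [TopologicalSpace A] [ChartedSpace E A]
  {F : Type*} [NormedAddCommGroup F] [NormedSpace ℂ F]
  {X : Type*} [TopologicalSpace X] [ChartedSpace F X]

/-- A polynomial mapping the unit disk to itself and vanishing at `0` and at `1 / (j + 2)` for
`j < m`. -/
noncomputable def vanishingPoly (m : ℕ) (t : ℂ) : ℂ :=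
  t * ∏ j ∈ Finset.range m, (t - 1 / (j + 2)) / 2

theorem differentiable_vanishingPoly (m : ℕ) : Differentiable ℂ (vanishingPoly m) := by
  unfold vanishingPoly
  fun_prop

theorem vanishingPoly_zero (m : ℕ) : vanishingPoly m 0 = 0 := zero_mul _

theorem vanishingPoly_one_div {m j : ℕ} (h : j < m) : vanishingPoly m (1 / (j + 2)) = 0 :=
  mul_eq_zero_of_right _ (Finset.prod_eq_zero (Finset.mem_range.2 h) (by simp))

theorem norm_one_div_lt (j : ℕ) : ‖(1 / (j + 2) : ℂ)‖ < 1 := by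
  have : ((j : ℂ) + 2) = ((j + 2 : ℕ) : ℂ) := by push_cast; ring
  rw [this, norm_div, norm_one, Complex.norm_natCast, div_lt_one (by positivity)]
  exact_mod_cast (by lia : 1 < j + 2)

theorem mapsTo_vanishingPoly (m : ℕ) :
    MapsTo (vanishingPoly m) (Metric.ball 0 1) (Metric.ball 0 1) := by
  intro t ht
  rw [mem_ball_zero_iff] at ht ⊢
  rw [vanishingPoly, norm_mul, norm_prod]
  refine (mul_le_of_le_one_right (norm_nonneg t)
    (Finset.prod_le_one (fun _ _ => norm_nonneg _) fun j _ => ?_)).trans_lt ht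
  rw [norm_div, Complex.norm_ofNat, div_le_one two_pos]
  linarith [norm_sub_le t (1 / (j + 2)), norm_one_div_lt j]

theorem vanishingPoly_neg_half_ne_zero (m : ℕ) : vanishingPoly m (-1 / 2) ≠ 0 := by
  refine mul_ne_zero (by norm_num) (Finset.prod_ne_zero_iff.2 fun j _ => ?_)
  refine div_ne_zero (sub_ne_zero.2 fun h => ?_) two_ne_zero
  have h2 : ((j : ℂ) + 2) ≠ 0 := by exact_mod_cast (by lia : j + 2 ≠ 0)
  rw [div_eq_div_iff two_ne_zero h2] at h
  have h3 : ((j + 4 : ℕ) : ℂ) = 0 := by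
    push_cast
    linear_combination -h
  exact absurd (Nat.cast_eq_zero.1 h3) (by lia)

theorem tendsto_one_div_nhdsNE :
    Tendsto (fun j : ℕ => (1 / (j + 2) : ℂ)) atTop (𝓝[≠] 0) := by
  refine tendsto_nhdsWithin_iff.2 ⟨?_, Eventually.of_forall fun j => ?_⟩
  · have := (tendsto_one_div_atTop_nhds_zero_nat (𝕜 := ℂ)).comp (tendsto_add_atTop_nat 2)
    refine this.congr fun j => ?_
    simp
  · have h2 : ((j : ℂ) + 2) ≠ 0 := by exact_mod_cast (by lia : j + 2 ≠ 0)
    exact one_div_ne_zero h2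

/-- The weak Vitali property for the disk forces sequences of holomorphic maps to be
equicontinuous wherever they stay bounded. -/
theorem HasOneWVP.tendsto_of_tendsto [IsManifold 𝓘(ℂ, E) 1 A] [T2Space X]
    [FiniteDimensional ℂ F] [IsManifold 𝓘(ℂ, F) 1 X]
    (hX : HasOneWVP F X) {f : ℕ → Hol E A F X} {a b : ℕ → A} {z : A} {x : X}
    (ha : Tendsto a atTop (𝓝 z)) (hb : Tendsto b atTop (𝓝 z))
    (hf : Tendsto (fun k => (f k).1 (a k)) atTop (𝓝 x)) :
    Tendsto (fun k => (f k).1 (b k)) atTop (𝓝 x) := by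
  by_contra hcon
  obtain ⟨V, hV, hfr⟩ := not_tendsto_iff_exists_frequently_notMem.1 hcon
  -- The neighbourhood in which disks can be drawn shrinks with `vanishingPoly m (-1 / 2)`, so `k`
  -- has to be chosen after `m`.
  have hdisk : ∀ m : ℕ, ∃ᶠ k in atTop, (f k).1 (b k) ∉ V ∧ ∃ c : ℂ → A,
      MDifferentiableOn 𝓘(ℂ, ℂ) 𝓘(ℂ, E) c (Metric.ball 0 1) ∧ c 0 = a k ∧
        c (vanishingPoly m (-1 / 2)) = b k := by
    intro m
    obtain ⟨N, hN, -, hc⟩ := exists_disk_through (E := E) (univ_mem : univ ∈ 𝓝 z)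
      (vanishingPoly_neg_half_ne_zero m)
    refine (hfr.and_eventually ((ha.eventually_mem hN).and (hb.eventually_mem hN))).mono ?_
    rintro k ⟨hk, hak, hbk⟩
    obtain ⟨c, h1, -, h2, h3⟩ := hc _ hak _ hbk
    exact ⟨hk, c, h1, h2, h3⟩
  obtain ⟨φ, hφ, hP⟩ := extraction_forall_of_frequently hdisk
  choose hnot c hc hc0 hcε using hP
  -- `G m` takes the value of `f (φ m)` at `a (φ m)` at `0` and at the first `m` nodes, and its
  -- value at `b (φ m)` at `-1 / 2`.
  let G : ℕ → ℂ → X := fun m t => (f (φ m)).1 (c m (vanishingPoly m t))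
  have hG : ∀ m, MDifferentiableOn 𝓘(ℂ, ℂ) 𝓘(ℂ, F) (G m) (Metric.ball 0 1) := fun m =>
    (f (φ m)).2.comp_mdifferentiableOn ((hc m).comp
      (differentiable_vanishingPoly m).mdifferentiable.mdifferentiableOn (mapsTo_vanishingPoly m))
  have hlim : Tendsto (fun m => (f (φ m)).1 (a (φ m))) atTop (𝓝 x) := hf.comp hφ.tendsto_atTop
  have hG0 : Tendsto (fun m => G m 0) atTop (𝓝 x) :=
    hlim.congr fun m => by simp only [G, vanishingPoly_zero, hc0]
  have hGj : ∀ j : ℕ, Tendsto (fun m => G m (1 / (j + 2))) atTop (𝓝 x) := fun j =>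
    hlim.congr' ((eventually_gt_atTop j).mono fun m hm => by
      simp only [G, vanishingPoly_one_div hm, hc0])
  have hfrq : ∃ᶠ t in 𝓝[≠] (0 : ℂ), Tendsto (fun m => G m t) atTop (𝓝 x) :=
    tendsto_one_div_nhdsNE.frequently (Eventually.of_forall hGj).frequently
  obtain ⟨g, hg⟩ := hX.exists_limit hG ⟨x, hG0⟩ (hfrq.mono fun t ht => ⟨x, ht⟩)
  have hgx : (g.1 : unitDisk → X) = fun _ => x := by
    have : ConnectedSpace unitDisk := isConnected_iff_connectedSpace.1
      ((convex_ball (0 : ℂ) 1).isConnected ⟨0, Metric.mem_ball_self one_pos⟩)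
    refine eq_of_uniquenessSet_nonempty (E := ℂ) (F := F) g.2 mdifferentiable_const
      ⟨⟨0, Metric.mem_ball_self one_pos⟩, ?_⟩
    exact uniquenessSet_mono (fun t ht => tendsto_nhds_unique (hg t) ht)
      (mem_uniquenessSet_unitDisk (S := {t | Tendsto (fun m => G m t) atTop (𝓝 x)}) hfrq)
  have hend := hg ⟨-1 / 2, by change _ ∈ Metric.ball (0 : ℂ) 1; simp; norm_num⟩
  rw [hgx] at hend
  obtain ⟨m, hm⟩ := (hend.eventually_mem hV).exists
  refine hnot m ?_
  rw [← hcε m]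
  exact hm

/-- Pointwise convergence at `z` improves to continuous convergence at `z`. -/
theorem HasOneWVP.tendsto_uncurry [IsManifold 𝓘(ℂ, E) 1 A] [T2Space X]
    [FiniteDimensional ℂ F] [IsManifold 𝓘(ℂ, F) 1 X]
    (hX : HasOneWVP F X) {f : ℕ → Hol E A F X} {z : A} {x : X}
    (hf : Tendsto (fun k => (f k).1 z) atTop (𝓝 x)) :
    Tendsto (fun p : ℕ × A => (f p.1).1 p.2) (atTop ×ˢ 𝓝 z) (𝓝 x) := by
  have := firstCountableTopology_of_chartedSpace E A
  refine tendsto_of_seq_tendsto fun p hp => ?_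
  exact hX.tendsto_of_tendsto (f := fun n => f (p n).1) tendsto_const_nhds
    (tendsto_snd.comp hp) (hf.comp (tendsto_fst.comp hp))

end Equicontinuity

/-! ### From the 1-WVP to the WVP -/

section WeakVitali

variable {E : Type*} [NormedAddCommGroup E] [NormedSpace ℂ E]
  {A : Type*} [TopologicalSpace A] [ChartedSpace E A]
  {F : Type*} [NormedAddCommGroup F] [NormedSpace ℂ F]
  {X : Type*} [TopologicalSpace X] [ChartedSpace F X]

/-- Continuous convergence at `z` brings a tail of the sequence, on a whole neighbourhood, into a
compact neighbourhood of `x` inside one chart. Statements about bounded vector-valued maps then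
apply. -/
theorem exists_chart_localization [FiniteDimensional ℂ F] {f : ℕ → Hol E A F X} {z : A} {x : X}
    (hf : Tendsto (fun p : ℕ × A => (f p.1).1 p.2) (atTop ×ˢ 𝓝 z) (𝓝 x)) :
    ∃ (U : Set A) (V : Set X) (k₀ : ℕ) (M : ℝ), IsOpen U ∧ IsConnected U ∧ z ∈ U ∧
      IsCompact V ∧ V ⊆ (chartAt F x).source ∧ (∀ y ∈ V, ‖chartAt F x y‖ ≤ M) ∧
        ∀ k, ∀ w ∈ U, (f (k + k₀)).1 w ∈ V := by
  have : ProperSpace F := FiniteDimensional.proper ℂ F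
  have : LocallyCompactSpace X := ChartedSpace.locallyCompactSpace F X
  have hlc : LocallyConnectedSpace A := ChartedSpace.locallyConnectedSpace E A
  set e := chartAt F x
  obtain ⟨V, hVx, hVe, hV⟩ := local_compact_nhds (e.open_source.mem_nhds (mem_chart_source F x))
  obtain ⟨M, hM⟩ := (hV.image_of_continuousOn (e.continuousOn.mono hVe)).isBounded.exists_norm_le
  obtain ⟨p, hp, q, hq, hpq⟩ := eventually_prod_iff.1 (hf.eventually_mem hVx)
  obtain ⟨k₀, hk₀⟩ := eventually_atTop.1 hp
  obtain ⟨U, hUq, hU, hzU, hUc⟩ := locallyConnectedSpace_iff_subsets_isOpen_isConnected.1 hlc z _ hq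
  exact ⟨U, V, k₀, M, hU, hUc, hzU, hV, hVe, fun y hy => hM _ (mem_image_of_mem _ hy),
    fun k w hw => hpq (hk₀ _ (Nat.le_add_left _ _)) (hUq hw)⟩

theorem mdifferentiableOn_chart_comp [IsManifold 𝓘(ℂ, F) 1 X] {x : X} {U : Set A} {g : A → X}
    (hg : MDifferentiable 𝓘(ℂ, E) 𝓘(ℂ, F) g) (hU : ∀ w ∈ U, g w ∈ (chartAt F x).source) :
    MDifferentiableOn 𝓘(ℂ, E) 𝓘(ℂ, F) (fun w => chartAt F x (g w)) U :=
  (mdifferentiableOn_atlas (chart_mem_atlas F x)).comp hg.mdifferentiableOn hU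

/-- Vitali's theorem for sequences which are bounded near a point of the uniqueness set. -/
theorem convergenceSet_mem_nhds [IsManifold 𝓘(ℂ, E) 1 A] [T2Space X]
    [FiniteDimensional ℂ F] [IsManifold 𝓘(ℂ, F) 1 X] {f : ℕ → Hol E A F X} {z : A} {x : X}
    (hf : Tendsto (fun p : ℕ × A => (f p.1).1 p.2) (atTop ×ˢ 𝓝 z) (𝓝 x))
    (hz : z ∈ uniquenessSet E (convergenceSet f)) : convergenceSet f ∈ 𝓝 z := by
  obtain ⟨U, V, k₀, M, hU, hUc, hzU, hV, hVe, hM, hfV⟩ := exists_chart_localization hf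
  have hlim : ∀ (𝒰 : Ultrafilter ℕ) (w : A), ∃ y, w ∈ U →
      y ∈ V ∧ Tendsto (fun k => (f (k + k₀)).1 w) 𝒰 (𝓝 y) := by
    intro 𝒰 w
    by_cases hw : w ∈ U
    · obtain ⟨y, hyV, hy⟩ := hV.ultrafilter_le_nhds (𝒰.map fun k => (f (k + k₀)).1 w)
        (tendsto_principal.2 (Eventually.of_forall fun k => hfV k w hw))
      exact ⟨y, fun _ => ⟨hyV, hy⟩⟩
    · exact ⟨x, fun h => absurd h hw⟩
  choose g hg using hlim
  have hgd : ∀ 𝒰 : Ultrafilter ℕ,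
      MDifferentiableOn 𝓘(ℂ, E) 𝓘(ℂ, F) (fun w => chartAt F x (g 𝒰 w)) U := fun 𝒰 =>
    mdifferentiableOn_of_tendsto_of_norm_le (l := (𝒰 : Filter ℕ)) hU
      (fun k => mdifferentiableOn_chart_comp (f (k + k₀)).2 fun w hw => hVe (hfV k w hw))
      (fun k w hw => hM _ (hfV k w hw))
      (fun w hw => (((chartAt F x).continuousAt (hVe (hg 𝒰 w hw).1)).tendsto).comp (hg 𝒰 w hw).2)
  let 𝒱 : Ultrafilter ℕ := Ultrafilter.of atTop
  have h𝒱 : (𝒱 : Filter ℕ) ≤ atTop := Ultrafilter.of_le _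
  refine mem_of_superset (hU.mem_nhds hzU) fun w hw => ⟨g 𝒱 w, ?_⟩
  -- It suffices that all ultrafilter limits coincide at `w`. In the chart they are holomorphic on
  -- `U` and agree on the convergence set, so the uniqueness property at `z` identifies them.
  rw [← tendsto_add_atTop_iff_nat k₀, tendsto_iff_ultrafilter]
  intro 𝒰 h𝒰
  have heq := eqOn_of_mem_uniquenessSet hz hU hUc hzU (hgd 𝒰) (hgd 𝒱) ?_ hw
  · rw [← (chartAt F x).injOn (hVe (hg 𝒰 w hw).1) (hVe (hg 𝒱 w hw).1) heq]
    exact (hg 𝒰 w hw).2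
  · rintro v ⟨hvU, y, hy⟩
    rw [← tendsto_add_atTop_iff_nat k₀] at hy
    rw [tendsto_nhds_unique (hg 𝒰 v hvU).2 (hy.mono_left h𝒰),
      tendsto_nhds_unique (hg 𝒱 v hvU).2 (hy.mono_left h𝒱)]

theorem mdifferentiable_of_tendsto_uncurry [IsManifold 𝓘(ℂ, E) 1 A] [T2Space X]
    [FiniteDimensional ℂ F] [IsManifold 𝓘(ℂ, F) 1 X] {f : ℕ → Hol E A F X} {g : A → X}
    (hf : ∀ z, Tendsto (fun p : ℕ × A => (f p.1).1 p.2) (atTop ×ˢ 𝓝 z) (𝓝 (g z))) :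
    MDifferentiable 𝓘(ℂ, E) 𝓘(ℂ, F) g := by
  intro z
  obtain ⟨U, V, k₀, M, hU, hUc, hzU, hV, hVe, hM, hfV⟩ := exists_chart_localization (hf z)
  have hpt : ∀ w, Tendsto (fun k => (f (k + k₀)).1 w) atTop (𝓝 (g w)) := fun w =>
    ((hf w).comp (tendsto_id.prodMk (tendsto_const_nhds (x := w)))).comp (tendsto_add_atTop_nat k₀)
  have hgV : ∀ w ∈ U, g w ∈ V := fun w hw =>
    hV.isClosed.mem_of_tendsto (hpt w) (Eventually.of_forall fun k => hfV k w hw)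
  have hd : MDifferentiableOn 𝓘(ℂ, E) 𝓘(ℂ, F) (fun w => chartAt F (g z) (g w)) U :=
    mdifferentiableOn_of_tendsto_of_norm_le (l := atTop) hU
      (fun k => mdifferentiableOn_chart_comp (f (k + k₀)).2 fun w hw => hVe (hfV k w hw))
      (fun k w hw => hM _ (hfV k w hw))
      (fun w hw => (((chartAt F (g z)).continuousAt (hVe (hgV w hw))).tendsto).comp (hpt w))
  have hsymm : MDifferentiableAt 𝓘(ℂ, F) 𝓘(ℂ, F) (chartAt F (g z)).symm (chartAt F (g z) (g z)) :=
    mdifferentiableAt_atlas_symm (chart_mem_atlas F _) (mem_chart_target F _)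
  refine (hsymm.comp z ((hd z hzU).mdifferentiableAt (hU.mem_nhds hzU))).congr_of_eventuallyEq ?_
  filter_upwards [hU.mem_nhds hzU] with w hw
  exact ((chartAt F (g z)).left_inv (hVe (hgV w hw))).symm

/-- Continuous convergence at every point of a compact set is made uniform in `k` by a tube-lemma
argument. -/
theorem convergesInHol_of_tendsto_uncurry [IsManifold 𝓘(ℂ, E) 1 A] [T2Space X]
    [FiniteDimensional ℂ F] [IsManifold 𝓘(ℂ, F) 1 X] {f : ℕ → Hol E A F X} {g : A → X}
    (hf : ∀ z, Tendsto (fun p : ℕ × A => (f p.1).1 p.2) (atTop ×ˢ 𝓝 z) (𝓝 (g z))) :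
    ConvergesInHol f := by
  have hg := mdifferentiable_of_tendsto_uncurry hf
  refine ⟨⟨⟨g, hg.continuous⟩, hg⟩, tendsto_subtype_rng.2 ?_⟩
  refine ContinuousMap.tendsto_nhds_compactOpen.2 fun K hK O hO hKO => ?_
  have hmem : {p : ℕ × A | (f p.1).1 p.2 ∈ O} ∈ atTop ×ˢ 𝓝ˢ K :=
    hK.mem_prod_nhdsSet_of_forall fun z hz => hf z (hO.mem_nhds (hKO hz))
  obtain ⟨p, hp, q, hq, hpq⟩ := eventually_prod_iff.1 hmem
  exact hp.mono fun k hk z hz => hpq hk (hq.self_of_nhdsSet z hz)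

/-- The weak Vitali property for the disk implies the weak Vitali property for every connected
source manifold. -/
theorem HasOneWVP.weakVitaliFor [IsManifold 𝓘(ℂ, E) 1 A] [ConnectedSpace A] [T2Space X]
    [FiniteDimensional ℂ F] [IsManifold 𝓘(ℂ, F) 1 X] (hX : HasOneWVP F X) :
    WeakVitaliFor E A F X := by
  rintro f ⟨z, ⟨x, hx⟩, hz⟩
  have hnhds := convergenceSet_mem_nhds (hX.tendsto_uncurry hx) hz
  have hall : univ ⊆ convergenceSet f := by
    refine subset_of_disk_propagation (E := E) isOpen_univ isPreconnected_univ
      ⟨z, mem_univ z, mem_interior_iff_mem_nhds.2 hnhds⟩ fun c hc _ hc0 => ?_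
    obtain ⟨g, hg⟩ := hX.exists_limit (G := fun k t => (f k).1 (c t))
      (fun k => (f k).2.comp_mdifferentiableOn hc) hc0.self_of_nhds
      (hc0.filter_mono nhdsWithin_le_nhds).frequently
    exact ⟨_, hg ⟨1 / 2, by change _ ∈ Metric.ball (0 : ℂ) 1; simp; norm_num⟩⟩
  choose g hg using fun a => hall (mem_univ a)
  exact convergesInHol_of_tendsto_uncurry fun a => hX.tendsto_uncurry (hg a)

end WeakVitali

/-! ### Normality and the SVP -/

section Normality

variable {E : Type*} [NormedAddCommGroup E] [NormedSpace ℂ E]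
  {A : Type*} [TopologicalSpace A] [ChartedSpace E A]
  {F : Type*} [NormedAddCommGroup F] [NormedSpace ℂ F]
  {X : Type*} [TopologicalSpace X] [ChartedSpace F X]

theorem HasOneWVP.isNormalHol [IsManifold 𝓘(ℂ, E) 1 A] [ConnectedSpace A] [T2Space X]
    [FiniteDimensional ℂ F] [IsManifold 𝓘(ℂ, F) 1 X] (hX : HasOneWVP F X)
    (hA : LocallySeparable A) : IsNormalHol E A F X := by
  intro f
  by_cases hdiv : CompactlyDivergent f
  · exact ⟨id, strictMono_id, Or.inr hdiv⟩
  have := firstCountableTopology_of_chartedSpace E A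
  have := firstCountableTopology_of_chartedSpace F X
  simp only [CompactlyDivergent] at hdiv
  push Not at hdiv
  obtain ⟨K, L, hK, hL, hKL⟩ := hdiv
  obtain ⟨φ, hφ, hmeet⟩ := extraction_of_frequently_atTop (frequently_atTop.2 hKL)
  have hpts : ∀ j, ∃ a ∈ K, (f (φ j)).1 a ∈ L := fun j => by
    obtain ⟨_, ⟨a, ha, rfl⟩, hy⟩ := hmeet j
    exact ⟨a, ha, hy⟩
  choose a haK haL using hpts
  obtain ⟨z, -, φ', hφ', hz⟩ := hK.tendsto_subseq haK
  obtain ⟨x, -, φ'', hφ'', hx⟩ := hL.tendsto_subseq fun j => haL (φ' j)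
  let θ : ℕ → ℕ := φ ∘ φ' ∘ φ''
  have hθ : StrictMono θ := hφ.comp (hφ'.comp hφ'')
  -- Equicontinuity replaces the moving points of `K` by their limit `z`.
  have hzx : Tendsto (fun j => (f (θ j)).1 z) atTop (𝓝 x) :=
    hX.tendsto_of_tendsto (f := fun j => f (θ j)) (hz.comp hφ''.tendsto_atTop)
      tendsto_const_nhds hx
  obtain ⟨U, V, k₀, -, hU, -, hzU, hV, -, -, hfV⟩ :=
    exists_chart_localization (f := fun j => f (θ j)) (hX.tendsto_uncurry hzx)
  obtain ⟨W, hW, hWsep⟩ := hA z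
  obtain ⟨C, hC, hWC⟩ := TopologicalSpace.IsSeparable.of_subtype W
  have : Countable (C ∩ U : Set A) := (hC.mono inter_subset_left).to_subtype
  -- Diagonal argument: a countable power of `V` is sequentially compact, since the product space is
  -- first countable.
  obtain ⟨y, -, ψ, hψ, hy⟩ := (isCompact_univ_pi fun _ : (C ∩ U : Set A) => hV).tendsto_subseq
    (x := fun k (d : (C ∩ U : Set A)) => (f (θ (k + k₀))).1 d) (fun k d _ => hfV k d d.2.2)
  have hη : StrictMono fun j => ψ j + k₀ := hψ.add_const k₀
  refine ⟨fun j => θ (ψ j + k₀), hθ.comp hη, Or.inl ?_⟩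
  refine hX.weakVitaliFor (fun j => f (θ (ψ j + k₀)))
    ⟨z, ⟨x, hzx.comp hη.tendsto_atTop⟩, mem_uniquenessSet_of_mem_interior_closure ?_⟩
  have hsub : C ∩ U ⊆ convergenceSet fun j => f (θ (ψ j + k₀)) := fun d hd =>
    ⟨y ⟨d, hd⟩, (tendsto_pi_nhds.1 hy) ⟨d, hd⟩⟩
  rw [mem_interior_iff_mem_nhds]
  filter_upwards [hW, hU.mem_nhds hzU] with w hw hwU
  refine closure_mono hsub ?_
  rw [inter_comm]
  exact hU.inter_closure ⟨hwU, hWC hw⟩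

/-- Convergence at a single point rules out compact divergence of subsequences, as `X` is locally
compact. So every subsequence has a convergent one, and the identity theorem makes the limit
independent of the choice. -/
theorem IsNormalHol.strongVitaliFor [IsManifold 𝓘(ℂ, E) 1 A] [PreconnectedSpace A] [T2Space X]
    [FiniteDimensional ℂ F] [IsManifold 𝓘(ℂ, F) 1 X] (hN : IsNormalHol E A F X) :
    StrongVitaliFor E A F X := by
  rintro f ⟨z, hz⟩
  have : ProperSpace F := FiniteDimensional.proper ℂ F
  have : LocallyCompactSpace X := ChartedSpace.locallyCompactSpace F X
  obtain ⟨a, y, hy⟩ : (convergenceSet f).Nonempty := closure_nonempty_iff.1 ⟨z, hz.1⟩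
  have hsub : ∀ ns : ℕ → ℕ, Tendsto ns atTop atTop → ∃ ms : ℕ → ℕ, StrictMono ms ∧
      ∃ g, Tendsto (fun j => f (ns (ms j))) atTop (𝓝 g) := by
    intro ns hns
    obtain ⟨ms, hms, hconv | hdiv⟩ := hN fun j => f (ns j)
    · exact ⟨ms, hms, hconv⟩
    · exfalso
      obtain ⟨L, hL, hyL⟩ := exists_compact_mem_nhds y
      obtain ⟨j₀, hj₀⟩ := hdiv {a} L isCompact_singleton hL
      obtain ⟨j, hj, hjL⟩ := ((eventually_ge_atTop j₀).and
        ((hy.comp (hns.comp hms.tendsto_atTop)).eventually_mem hyL)).exists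
      exact (hj₀ j hj).subset ⟨mem_image_of_mem _ rfl, hjL⟩
  have hval : ∀ ns : ℕ → ℕ, Tendsto ns atTop atTop → ∀ g : Hol E A F X,
      Tendsto (fun j => f (ns j)) atTop (𝓝 g) → ∀ w ∈ convergenceSet f,
        Tendsto (fun k => (f k).1 w) atTop (𝓝 (g.1 w)) := by
    rintro ns hns g hg w ⟨v, hv⟩
    rwa [tendsto_nhds_unique (tendsto_apply hg w) (hv.comp hns)]
  obtain ⟨ms, hms, g, hg⟩ := hsub id tendsto_id
  refine ⟨g, tendsto_of_subseq_tendsto fun ns hns => ?_⟩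
  obtain ⟨ms', hms', g', hg'⟩ := hsub ns hns
  have heq : (g'.1 : A → X) = g.1 := eq_of_uniquenessSet_nonempty g'.2 g.2
    ⟨z, uniquenessSet_mono (fun w hw => tendsto_nhds_unique
      (hval _ (hns.comp hms'.tendsto_atTop) g' hg' w hw)
      (hval _ hms.tendsto_atTop g hg w hw)) hz⟩
  have : g' = g := Subtype.ext (DFunLike.coe_injective heq)
  exact ⟨ms', this ▸ hg'⟩

end Normality

/-! ### Back to the disk, across universes -/

section Transfer

variable {E : Type*} [NormedAddCommGroup E] [NormedSpace ℂ E]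
  {A : Type*} [TopologicalSpace A] [ChartedSpace E A]
  {E' : Type*} [NormedAddCommGroup E'] [NormedSpace ℂ E']
  {B : Type*} [TopologicalSpace B] [ChartedSpace E' B]
  {F : Type*} [NormedAddCommGroup F] [NormedSpace ℂ F]
  {X : Type*} [TopologicalSpace X] [ChartedSpace F X]

theorem mdifferentiable_codRestrict_opens {f : A → B} {U : TopologicalSpace.Opens B}
    (hf : MDifferentiable 𝓘(ℂ, E) 𝓘(ℂ, E') f) (h : ∀ a, f a ∈ U) :
    MDifferentiable 𝓘(ℂ, E) 𝓘(ℂ, E') (fun a => (⟨f a, h a⟩ : U)) := by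
  classical
  intro a
  -- The value off `U` is arbitrary: only the germ of `ρ` at `f a` matters.
  let ρ : B → U := fun b => if hb : b ∈ U then ⟨b, hb⟩ else ⟨f a, h a⟩
  have hρ : ρ ∘ Subtype.val = id := funext fun u => by simp [ρ]
  have hρd : MDifferentiableAt 𝓘(ℂ, E') 𝓘(ℂ, E') ρ (f a) := by
    refine (mdifferentiableAt_comp_subtype_val_iff (z := ⟨f a, h a⟩)).1 ?_
    rw [hρ]
    exact mdifferentiableAt_id
  have hcomp : ρ ∘ f = fun a => (⟨f a, h a⟩ : U) := funext fun b => by simp [ρ, h b]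
  rw [← hcomp]
  exact hρd.comp a (hf a)

theorem mdifferentiable_subtype_val (U : TopologicalSpace.Opens A) :
    MDifferentiable 𝓘(ℂ, E) 𝓘(ℂ, E) (Subtype.val : U → A) :=
  contMDiff_subtype_val.mdifferentiable one_ne_zero

/-- The strong Vitali property is invariant under biholomorphic maps of the source. -/
theorem StrongVitaliFor.of_homeomorph (i : A ≃ₜ B) (hi : MDifferentiable 𝓘(ℂ, E) 𝓘(ℂ, E') i)
    (hi' : MDifferentiable 𝓘(ℂ, E') 𝓘(ℂ, E) i.symm) (hB : StrongVitaliFor E' B F X) :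
    StrongVitaliFor E A F X := by
  rintro f ⟨z, hz, hz'⟩
  let f' : ℕ → Hol E' B F X := fun k => ⟨(f k).1.comp (i.symm : C(B, A)), (f k).2.comp hi'⟩
  have hf' : ∀ k a, (f' k).1 (i a) = (f k).1 a := fun k a =>
    congrArg (f k).1 (i.symm_apply_apply a)
  have hmaps : MapsTo i (convergenceSet f) (convergenceSet f') := fun a ⟨x, hx⟩ =>
    ⟨x, by simpa only [hf'] using hx⟩
  have hiz : i z ∈ uniquenessSet E' (convergenceSet f') := by
    refine ⟨map_mem_closure i.continuous hz hmaps, fun U hU hUc hzU h hh h0 w hw => ?_⟩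
    have hconn : IsConnected (i ⁻¹' U) := by
      rw [← i.image_symm]
      exact hUc.image _ i.symm.continuous.continuousOn
    have := hz' (i ⁻¹' U) (hU.preimage i.continuous) hconn hzU (h ∘ i)
      (hh.comp hi.mdifferentiableOn subset_rfl) (fun a ha => h0 (i a) ⟨ha.1, hmaps ha.2⟩)
      (i.symm w) (by simpa using hw)
    simpa using this
  obtain ⟨g, hg⟩ := hB f' ⟨i z, hiz⟩
  refine ⟨⟨g.1.comp (i : C(A, B)), g.2.comp hi⟩, tendsto_subtype_rng.2 ?_⟩
  have := ((ContinuousMap.continuous_precomp (Z := X) (i : C(A, B))).tendsto g.1).comp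
    ((continuous_subtype_val.tendsto g).comp hg)
  refine this.congr fun k => ?_
  ext a
  exact hf' k a

theorem StrongVitaliFor.weakVitaliFor (h : StrongVitaliFor E A F X) : WeakVitaliFor E A F X :=
  fun f hf => h f (hf.mono inter_subset_right)

end Transfer

universe u

/-- The unit disk of `ULift ℂ`. -/
def liftedDisk : TopologicalSpace.Opens (ULift.{u} ℂ) :=
  ⟨ULift.down ⁻¹' unitDisk, unitDisk.isOpen.preimage continuous_uliftDown⟩

/-- The unit disk is homeomorphic to its lift to another universe. -/
def unitDiskHomeomorph : unitDisk ≃ₜ liftedDisk.{u} where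
  toFun t := ⟨⟨t⟩, t.2⟩
  invFun t := ⟨t.1.down, t.2⟩
  continuous_toFun := (continuous_uliftUp.comp continuous_subtype_val).subtype_mk _
  continuous_invFun := (continuous_uliftDown.comp continuous_subtype_val).subtype_mk _

/-- The sources in the hypothesis live in universe `u`, so the SVP is applied to the disk in `ULift
ℂ` and pulled back along the biholomorphism. -/
theorem HasSVPForLocallySeparable.hasOneWVP {F : Type*} [NormedAddCommGroup F] [NormedSpace ℂ F]
    {X : Type*} [TopologicalSpace X] [ChartedSpace F X]
    (h : HasSVPForLocallySeparable.{u} F X) : HasOneWVP F X := by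
  have : ConnectedSpace unitDisk := isConnected_iff_connectedSpace.1
    ((convex_ball (0 : ℂ) 1).isConnected ⟨0, Metric.mem_ball_self one_pos⟩)
  have : ConnectedSpace liftedDisk.{u} :=
    unitDiskHomeomorph.surjective.connectedSpace unitDiskHomeomorph.continuous
  have : SecondCountableTopology liftedDisk.{u} :=
    unitDiskHomeomorph.symm.isInducing.secondCountableTopology
  refine StrongVitaliFor.weakVitaliFor (StrongVitaliFor.of_homeomorph unitDiskHomeomorph.{u} ?_ ?_
    (h (ULift.{u} ℂ) liftedDisk.{u} fun _ => ⟨univ, univ_mem, inferInstance⟩))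
  · have hup : MDifferentiable 𝓘(ℂ, ℂ) 𝓘(ℂ, ULift.{u} ℂ) (ULift.up : ℂ → ULift.{u} ℂ) :=
      (ContinuousLinearEquiv.ulift (R₁ := ℂ) (M₁ := ℂ)).symm.differentiable.mdifferentiable
    exact mdifferentiable_codRestrict_opens (U := liftedDisk.{u}) (hup.comp (mdifferentiable_subtype_val unitDisk))
      fun t => t.2
  · have hdown : MDifferentiable 𝓘(ℂ, ULift.{u} ℂ) 𝓘(ℂ, ℂ) (ULift.down : ULift.{u} ℂ → ℂ) :=
      (ContinuousLinearEquiv.ulift (R₁ := ℂ) (M₁ := ℂ)).differentiable.mdifferentiable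
    exact mdifferentiable_codRestrict_opens (U := unitDisk)
      (hdown.comp (mdifferentiable_subtype_val liftedDisk)) fun t => t.2

end Vitali

universe u v w

theorem theorem3p14
    (F : Type v) [NormedAddCommGroup F] [NormedSpace ℂ F] [FiniteDimensional ℂ F]
    (X : Type w) [TopologicalSpace X] [T2Space X]
    [ChartedSpace F X] [IsManifold 𝓘(ℂ, F) ω X] :
    List.TFAE
      [Vitali.HasOneWVP F X,
       Vitali.NormalForLocallySeparable.{u} F X,
       Vitali.HasSVPForLocallySeparable.{u} F X] ∧
    (Vitali.HasOneWVP F X → Vitali.HasWVP.{u} F X) := by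
  refine ⟨?_, fun hX E _ _ _ A _ _ _ _ _ => hX.weakVitaliFor⟩
  tfae_have 1 → 2 := fun hX E _ _ _ A _ _ _ _ _ hA => hX.isNormalHol hA
  tfae_have 2 → 3 := fun hN E _ _ _ A _ _ _ _ _ hA => (hN E A hA).strongVitaliFor
  tfae_have 3 → 1 := fun hS => hS.hasOneWVP
  tfae_finish
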